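/- Let $N\ge 2$ and let $A=(A_{ij})_{0\le i,j\le N-1}$ be a matrix with entries in $\{0,1\}$ which is irreducible in the sense that some power $A^n$ has all entries positive. Let $\Lambda_A\subset[0,1]$ be the set of all numbers $x=\sum_{k\ge0}x_kN^{-k-1}$ with digits $x_k\in\{0,\dots,N-1\}$ satisfying $A_{x_k x_{k+1}}=1$ for all $k\ge 0$ (call $(x_k)$ an admissible expansion of $x$). For $0\le i\le N-1$ let $D_i\subset\Lambda_A$ be the set of numbers that have an admissible expansion with $A_{i x_0}=1$, let $\sigma_i:D_i\to\Lambda_A$, $\sigma_i(x)=(x+i)/N$ (the map that puts the digit $i$ in front of an expansion), and let $R_i=\sigma_i(D_i)$. Let $\delta_A=\dim_H\Lambda_A$ be the Hausdorff dimension, $\mathcal H^{\delta_A}$ the $\delta_A$-dimensional Hausdorff measure, and $r(A)$ the spectral radius of $A$. Then $0<\mathcal H^{\delta_A}(\Lambda_A)<\infty$, and the normalized Hausdorff measure $\mu=\mathcal H^{\delta_A}|_{\Lambda_A}/\mathcal H^{\delta_A}(\Lambda_A)$ has the following properties. 1. For each $i$, the measure $\mu\circ\sigma_i: E\mapsto\mu(\sigma_i(E))$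 on $D_i$ is absolutely continuous with respect to $\mu|_{D_i}$, with constant Radon–Nikodym derivative $$\Phi_{\sigma_i}=\frac{d(\mu\circ\sigma_i)}{d\mu}=N^{-\delta_A}\quad\mu\text{-a.e. on }D_i;$$ that is, $\mu(\sigma_i(E))=N^{-\delta_A}\mu(E)$ for all Borel sets $E\subset D_i$. 2. There is exactly one vector $p\in\mathbb R^N$ with $\sum_jA_{ij}p_j=r(A)\,p_i$ for all $i$ and $\sum_ip_i=1$ (the normalized Perron–Frobenius eigenvector of $A$); its entries are positive, and $\mu(R_i)=p_i$ for all $i$. 3. $\delta_A=\dim_H\Lambda_A=\dfrac{\log r(A)}{\log N}$. 4. $\mu=N^{-\delta_A}\sum_{k=0}^{N-1}\mu\circ\sigma_k^{-1}$, where $\mu(\sigma_k^{-1}(E))=\mu(\{x\in D_k: \sigma_k(x)\in E\})$ for Borel sets $E$. -/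

import Mathlib

open MeasureTheory
open scoped ENNReal

noncomputable section

namespace AdmissibleCantor

variable {N : ℕ}

/-- Admissible infinite words: sequences of digits whose consecutive letters `ij` satisfy
`A i j = 1`. -/
def words (A : Matrix (Fin N) (Fin N) ℝ) : Set (ℕ → Fin N) :=
  {w | ∀ n, A (w n) (w (n + 1)) = 1}

/-- The Cantor set `Λ_A ⊆ [0,1]` of all real numbers `0.x₀x₁x₂…` (in base `N`) having an
admissible expansion. -/
def limitSet (A : Matrix (Fin N) (Fin N) ℝ) : Set ℝ :=
  Real.ofDigits '' words A

/-- The domain `D_i ⊆ Λ_A`: numbers having an admissible expansion `0.x₀x₁x₂…`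
with `A i x₀ = 1`. -/
def dom (A : Matrix (Fin N) (Fin N) ℝ) (i : Fin N) : Set ℝ :=
  Real.ofDigits '' {w | w ∈ words A ∧ A i (w 0) = 1}

/-- The map `0.x₀x₁x₂… ↦ 0.ix₀x₁x₂…`, that is, `x ↦ (x + i) / N`. It is used on `dom A i`. -/
def sigma (i : Fin N) (x : ℝ) : ℝ := (x + (i : ℕ)) / N

/-- The range `R_i = σ_i(D_i)`. -/
def range (A : Matrix (Fin N) (Fin N) ℝ) (i : Fin N) : Set ℝ :=
  sigma i '' dom A i

/-- The map `sigma i` puts the digit `i` in front of an expansion. -/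
theorem ofDigits_cons (i : Fin N) (w : ℕ → Fin N) :
    Real.ofDigits (fun n => Nat.casesOn n i w : ℕ → Fin N) = sigma i (Real.ofDigits w) := by
  rw [Real.ofDigits_eq_sum_add_ofDigits _ 1]
  simp [Real.ofDigitsTerm, sigma]
  ring

/-- `R_i` is the set of numbers having an admissible expansion with first digit `i`. -/
theorem range_eq (A : Matrix (Fin N) (Fin N) ℝ) (i : Fin N) :
    range A i = Real.ofDigits '' {w | w ∈ words A ∧ w 0 = i} := by
  ext x
  constructor
  · rintro ⟨_, ⟨w, ⟨hw, hi⟩, rfl⟩, rfl⟩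
    refine ⟨fun n => Nat.casesOn n i w, ⟨?_, rfl⟩, ofDigits_cons i w⟩
    intro n
    cases n with
    | zero => exact hi
    | succ n => exact hw n
  · rintro ⟨w, ⟨hw, rfl⟩, rfl⟩
    refine ⟨_, ⟨fun n => w (n + 1), ⟨fun n => hw (n + 1), hw 0⟩, rfl⟩, ?_⟩
    rw [← ofDigits_cons]
    congr 1
    ext n
    cases n <;> rfl

/-- The Hausdorff dimension `δ_A` of `Λ_A`, as a real number. -/
def dimension (A : Matrix (Fin N) (Fin N) ℝ) : ℝ := (dimH (limitSet A)).toReal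

/-- The normalized `δ_A`-dimensional Hausdorff measure of `Λ_A`, as a measure on `ℝ`. -/
def hMeasure (A : Matrix (Fin N) (Fin N) ℝ) : Measure ℝ :=
  (Measure.hausdorffMeasure (dimension A) (limitSet A))⁻¹ •
    (Measure.hausdorffMeasure (dimension A)).restrict (limitSet A)

/-- The spectral radius `r(A)`: the largest modulus of a complex eigenvalue. -/
def specRadius (A : Matrix (Fin N) (Fin N) ℝ) : ℝ :=
  (spectralRadius ℂ (A.map Complex.ofReal)).toReal

/-- The measure `μ ∘ σ_i` on `D_i`, that is, `E ↦ μ(σ_i(E))` for measurable `E ⊆ D_i`. -/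
def measureComp (A : Matrix (Fin N) (Fin N) ℝ) (i : Fin N) : Measure ℝ :=
  ((hMeasure A).comap (sigma i)).restrict (dom A i)

/-- The measure `μ ∘ σ_i⁻¹`, that is, `E ↦ μ({x ∈ D_i | σ_i(x) ∈ E})`. -/
def measureCompInv (A : Matrix (Fin N) (Fin N) ℝ) (i : Fin N) : Measure ℝ :=
  ((hMeasure A).restrict (dom A i)).map (sigma i)

end AdmissibleCantor

end

/-! ### Perron–Frobenius theory -/

namespace PerronFrobenius

open Matrix

variable {ι : Type*} [Fintype ι]

/-! Let `r` be the Perron eigenvalue of `A`, `p` its positive normalized eigenvector and `δ = log r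
/ log N`, so that `N ^ δ = r`. The transition weights `A i j * p j / (r * p i)` define a Markov
measure giving an admissible cylinder `u₀…uₙ` the mass `r⁻ⁿ p(uₙ)`. Up to constants this is the
`δ`-th power of the bound `N⁻ⁿ⁻¹` for the diameter of the cylinder's image. The mass distribution
principle then bounds the `δ`-dimensional Hausdorff measure of `Λ_A` away from zero
(`hausdorffMeasure_limitSet_pos`), and covering by cylinders shows that it is finite
(`hausdorffMeasure_limitSet_lt_top`). Hence `δ = δ_A`.

The rest is self-similarity. Each `sigma i` is a similarity of ratio `1 / N`, so it scales the
measure by `N ^ (-δ)`. Distinct ranges meet in at most one point, which is null because `r > 1`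
makes `δ` positive. So `Λ_A` is an almost disjoint union of all `R_i`, and `D_i` of those `R_j` with
`A i j = 1`. Scaling turns this into `A m = N ^ δ m` for the vector `m` of masses of the ranges;
since `N ^ δ = r` is a simple eigenvalue, `m = p`. -/

theorem mulVec_pos {M : Matrix ι ι ℝ} (hM : ∀ i j, 0 < M i j) {v : ι → ℝ}
    (hv : ∀ i, 0 ≤ v i) (hv0 : v ≠ 0) (i : ι) : 0 < (M *ᵥ v) i := by
  obtain ⟨j, hj⟩ := Function.ne_iff.1 hv0
  exact Finset.sum_pos' (fun k _ => mul_nonneg (hM i k).le (hv k))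
    ⟨j, Finset.mem_univ _, mul_pos (hM i j) (lt_of_le_of_ne (hv j) (Ne.symm hj))⟩

theorem pow_mulVec_of_eigen [DecidableEq ι] {A : Matrix ι ι ℝ} {r : ℝ} {p : ι → ℝ}
    (hp : A *ᵥ p = r • p) (n : ℕ) : (A ^ n) *ᵥ p = r ^ n • p := by
  induction n with
  | zero => simp
  | succ n ih => rw [pow_succ, ← mulVec_mulVec, hp, mulVec_smul, ih, smul_smul, pow_succ']

/-- The Collatz–Wielandt argument: a nonnegative matrix with a positive power has a positive
eigenvector. -/
theorem exists_pos_eigenvector [DecidableEq ι] [Nonempty ι] {A : Matrix ι ι ℝ}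
    (h0 : ∀ i j, 0 ≤ A i j) {n : ℕ} (hn : ∀ i j, 0 < (A ^ n) i j) :
    ∃ (r : ℝ) (p : ι → ℝ), 0 ≤ r ∧ (∀ i, 0 < p i) ∧ A *ᵥ p = r • p ∧ ∑ i, p i = 1 := by
  set C : ℝ := ∑ i, ∑ j, A i j
  -- The largest `r` admitting some `x` in the simplex with `r x ≤ A x` is the eigenvalue. The bound
  -- `C` only makes the set compact: summing the inequality over coordinates gives `r ≤ C`.
  set T : Set (ℝ × (ι → ℝ)) :=
    (Set.Icc 0 C ×ˢ stdSimplex ℝ ι) ∩ {z | ∀ i, z.1 * z.2 i ≤ (A *ᵥ z.2) i} with hT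
  have hTc : IsCompact T := by
    refine (isCompact_Icc.prod (isCompact_stdSimplex ℝ ι)).inter_right ?_
    simp only [Set.ofPred_forall]
    refine isClosed_iInter fun i => isClosed_le (by fun_prop) ?_
    exact (continuous_apply i).comp (Continuous.matrix_mulVec continuous_const continuous_snd)
  have hC : 0 ≤ C := Finset.sum_nonneg fun i _ => Finset.sum_nonneg fun j _ => h0 i j
  have hTn : T.Nonempty := by
    obtain ⟨x, hx⟩ : (stdSimplex ℝ ι).Nonempty :=
      ⟨_, single_mem_stdSimplex ℝ (Classical.arbitrary ι)⟩
    refine ⟨(0, x), ⟨⟨le_rfl, hC⟩, hx⟩, fun i => ?_⟩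
    simp only [zero_mul]
    exact Finset.sum_nonneg fun j _ => mul_nonneg (h0 i j) (hx.1 j)
  obtain ⟨⟨r, x⟩, ⟨⟨hr, hx⟩, hrx⟩, hmax⟩ := hTc.exists_isMaxOn hTn continuous_fst.continuousOn
  replace hr : 0 ≤ r := hr.1
  replace hx : x ∈ stdSimplex ℝ ι := hx
  replace hrx : ∀ i, r * x i ≤ (A *ᵥ x) i := hrx
  have hx0 : x ≠ 0 := by
    rintro rfl
    simpa using hx.2
  have heq : A *ᵥ x = r • x := by
    by_contra hne
    -- Applying the positive matrix `A ^ n` makes every coordinate of the slack `A x - r x` strictly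
    -- positive, which leaves room to increase `r`.
    set y := (A ^ n) *ᵥ x with hy
    have hypos : ∀ i, 0 < y i := mulVec_pos hn hx.1 hx0
    have hgap : ∀ i, 0 < (A *ᵥ y - r • y) i := by
      have : A *ᵥ y - r • y = (A ^ n) *ᵥ (A *ᵥ x - r • x) := by
        rw [mulVec_sub, mulVec_smul, hy, mulVec_mulVec, mulVec_mulVec, ← pow_succ, ← pow_succ']
      rw [this]
      exact mulVec_pos hn (fun i => sub_nonneg.2 (hrx i)) (sub_ne_zero.2 hne)
    set s := ∑ i, y i with hs
    have hspos : 0 < s := Finset.sum_pos (fun i _ => hypos i) Finset.univ_nonempty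
    obtain ⟨i₀, -, hi₀⟩ := Finset.exists_min_image Finset.univ (fun i => (A *ᵥ y - r • y) i)
      Finset.univ_nonempty
    set e := (A *ᵥ y - r • y) i₀ with he
    have hle : ∀ i, (r + e / s) * y i ≤ (A *ᵥ y) i := by
      intro i
      have h1 : y i ≤ s := Finset.single_le_sum (fun j _ => (hypos j).le) (Finset.mem_univ i)
      have h2 : e ≤ (A *ᵥ y) i - r * y i := by simpa using hi₀ i (Finset.mem_univ i)
      have h3 : e / s * y i ≤ e := by
        rw [div_mul_eq_mul_div, div_le_iff₀ hspos]
        exact mul_le_mul_of_nonneg_left h1 (hgap i₀).le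
      linarith
    have hes : 0 < e / s := div_pos (hgap i₀) hspos
    set z := s⁻¹ • y with hz
    have hzS : z ∈ stdSimplex ℝ ι := by
      refine ⟨fun i => mul_nonneg (inv_nonneg.2 hspos.le) (hypos i).le, ?_⟩
      simp only [hz, Pi.smul_apply, smul_eq_mul, ← Finset.mul_sum, ← hs]
      exact inv_mul_cancel₀ hspos.ne'
    have hzle : ∀ i, (r + e / s) * z i ≤ (A *ᵥ z) i := by
      intro i
      rw [hz, mulVec_smul, Pi.smul_apply, Pi.smul_apply, smul_eq_mul, smul_eq_mul, mul_left_comm]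
      exact mul_le_mul_of_nonneg_left (hle i) (inv_nonneg.2 hspos.le)
    have hzC : r + e / s ≤ C := by
      calc r + e / s = ∑ i, (r + e / s) * z i := by rw [← Finset.mul_sum, hzS.2, mul_one]
        _ ≤ ∑ i, (A *ᵥ z) i := Finset.sum_le_sum fun i _ => hzle i
        _ ≤ C := by
          refine Finset.sum_le_sum fun i _ => Finset.sum_le_sum fun j _ => ?_
          refine mul_le_of_le_one_right (h0 i j) ?_
          rw [← hzS.2]
          exact Finset.single_le_sum (fun k _ => hzS.1 k) (Finset.mem_univ j)
    have hm : r + e / s ≤ r := hmax (a := (r + e / s, z)) ⟨⟨⟨by positivity, hzC⟩, hzS⟩, hzle⟩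
    linarith
  refine ⟨r, x, hr, fun i => ?_, heq, hx.2⟩
  -- The vector `A ^ n x = r ^ n x` is positive, hence so is `x`.
  have h := mulVec_pos hn hx.1 hx0 i
  rw [pow_mulVec_of_eigen heq, Pi.smul_apply, smul_eq_mul] at h
  exact pos_of_mul_pos_right h (pow_nonneg hr n)

/-- The eigenspace of the Perron–Frobenius eigenvalue is one-dimensional. -/
theorem eigenvector_unique [DecidableEq ι] {A : Matrix ι ι ℝ}
    {n : ℕ} (hn : ∀ i j, 0 < (A ^ n) i j) {r : ℝ} {p q : ι → ℝ} (hp : ∀ i, 0 < p i)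
    (hAp : A *ᵥ p = r • p) (hAq : A *ᵥ q = r • q) (hp1 : ∑ i, p i = 1) (hq1 : ∑ i, q i = 1) :
    q = p := by
  cases isEmpty_or_nonempty ι
  · exact Subsingleton.elim _ _
  -- Subtract the largest multiple of `p` that keeps `q - t p` nonnegative. The difference vanishes
  -- at `i₀`; if it were nonzero, `A ^ n` would make it positive there.
  obtain ⟨i₀, -, hi₀⟩ := Finset.exists_min_image Finset.univ (fun i => q i / p i)
    Finset.univ_nonempty
  set t := q i₀ / p i₀ with ht
  have hv : ∀ i, 0 ≤ (q - t • p) i := fun i => by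
    have := (le_div_iff₀ (hp i)).1 (hi₀ i (Finset.mem_univ i))
    simpa using this
  have hA : A *ᵥ (q - t • p) = r • (q - t • p) := by
    rw [mulVec_sub, mulVec_smul, hAp, hAq, smul_sub, smul_comm]
  have h0 : q - t • p = 0 := by
    by_contra hne
    have h := mulVec_pos hn hv hne i₀
    rw [pow_mulVec_of_eigen hA] at h
    have : (q - t • p) i₀ = 0 := by
      simp [ht, div_mul_cancel₀ _ (hp i₀).ne']
    simp [this] at h
  have hq : q = t • p := sub_eq_zero.1 h0
  have : t = 1 := by
    rw [hq] at hq1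
    simpa [← Finset.mul_sum, hp1] using hq1
  rw [hq, this, one_smul]

/-- A positive eigenvector belongs to the spectral radius. -/
theorem spectralRadius_eq [DecidableEq ι] [Nonempty ι] {A : Matrix ι ι ℝ}
    (h0 : ∀ i j, 0 ≤ A i j) {r : ℝ} (hr : 0 ≤ r) {p : ι → ℝ} (hp : ∀ i, 0 < p i)
    (hAp : A *ᵥ p = r • p) : (spectralRadius ℂ (A.map Complex.ofReal)).toReal = r := by
  have hspec : ∀ z : ℂ, z ∈ spectrum ℂ (A.map Complex.ofReal) ↔
      ∃ v : ι → ℂ, v ≠ 0 ∧ (A.map Complex.ofReal) *ᵥ v = z • v := by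
    intro z
    rw [spectrum.mem_iff, Matrix.isUnit_iff_isUnit_det, isUnit_iff_ne_zero, not_not,
      ← Matrix.exists_mulVec_eq_zero_iff]
    refine exists_congr fun v => and_congr_right fun _ => ?_
    rw [sub_mulVec, sub_eq_zero, Algebra.algebraMap_eq_smul_one, smul_mulVec, one_mulVec, eq_comm]
  have hle : ∀ z ∈ spectrum ℂ (A.map Complex.ofReal), ‖z‖ ≤ r := by
    intro z hz
    obtain ⟨v, hv0, hv⟩ := (hspec z).1 hz
    -- In the weighted sup norm `max ‖v i‖ / p i` the matrix has norm at most `r`; evaluate at the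
    -- coordinate attaining the maximum.
    obtain ⟨i, -, hi⟩ := Finset.exists_max_image Finset.univ (fun i => ‖v i‖ / p i)
      Finset.univ_nonempty
    set c := ‖v i‖ / p i with hc
    have hvc : ∀ j, ‖v j‖ ≤ c * p j := fun j => (div_le_iff₀ (hp j)).1 (hi j (Finset.mem_univ j))
    have hcpos : 0 < c := by
      obtain ⟨j, hj⟩ := Function.ne_iff.1 hv0
      exact pos_of_mul_pos_left ((norm_pos_iff.2 hj).trans_le (hvc j)) (hp j).le
    have hvi : ‖v i‖ = c * p i := by rw [hc, div_mul_cancel₀ _ (hp i).ne']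
    have h1 : ‖z‖ * ‖v i‖ ≤ c * (r * p i) := by
      calc ‖z‖ * ‖v i‖ = ‖((A.map Complex.ofReal) *ᵥ v) i‖ := by rw [hv]; simp
        _ ≤ ∑ j, ‖(A i j : ℂ) * v j‖ := norm_sum_le _ _
        _ ≤ ∑ j, A i j * (c * p j) := by
          refine Finset.sum_le_sum fun j _ => ?_
          rw [norm_mul, Complex.norm_of_nonneg (h0 i j)]
          exact mul_le_mul_of_nonneg_left (hvc j) (h0 i j)
        _ = c * (A *ᵥ p) i := by
          rw [mulVec, dotProduct, Finset.mul_sum]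
          exact Finset.sum_congr rfl fun j _ => by ring
        _ = c * (r * p i) := by rw [hAp]; simp
    have hcp : 0 < c * p i := mul_pos hcpos (hp i)
    rw [hvi] at h1
    refine le_of_mul_le_mul_right ?_ hcp
    linarith
  have hmem : (r : ℂ) ∈ spectrum ℂ (A.map Complex.ofReal) := by
    refine (hspec _).2 ⟨fun i => (p i : ℂ), ?_, ?_⟩
    · intro h
      have := congrFun h (Classical.arbitrary ι)
      exact (hp _).ne' (by simpa using this)
    · ext i
      have := congrFun hAp i
      simp only [mulVec, dotProduct, Pi.smul_apply, smul_eq_mul, map_apply] at this ⊢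
      exact_mod_cast this
  have : spectralRadius ℂ (A.map Complex.ofReal) = ENNReal.ofReal r := by
    refine le_antisymm (iSup₂_le fun z hz => ?_) ?_
    · rw [← enorm_eq_nnnorm, ← ofReal_norm]
      exact ENNReal.ofReal_le_ofReal (hle z hz)
    · refine le_trans (le_of_eq ?_) (le_iSup₂ (r : ℂ) hmem)
      rw [← enorm_eq_nnnorm, ← ofReal_norm, Complex.norm_of_nonneg hr]
  rw [this, ENNReal.toReal_ofReal hr]

/-- The entries of `A ^ n` are positive integers, hence at least 1. With two distinct indices, `r ^
n * p i ≥ p i + p j > p i`. -/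
theorem one_lt_eigenvalue [DecidableEq ι] [Nontrivial ι] {A : Matrix ι ι ℝ}
    (hA : ∀ i j, A i j = 0 ∨ A i j = 1) {n : ℕ} (hn : ∀ i j, 0 < (A ^ n) i j) {r : ℝ}
    (hr : 0 ≤ r) {p : ι → ℝ} (hp : ∀ i, 0 < p i) (hAp : A *ᵥ p = r • p) : 1 < r := by
  have hint : ∀ (m : ℕ) i j, ∃ k : ℕ, (A ^ m) i j = k := by
    classical
    set B : Matrix ι ι ℕ := fun i j => if A i j = 1 then 1 else 0 with hB
    have hAB : A = B.map (Nat.castRingHom ℝ) := by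
      ext i j
      change A i j = ((if A i j = 1 then 1 else 0 : ℕ) : ℝ)
      rcases hA i j with h | h <;> simp [h]
    intro m i j
    refine ⟨(B ^ m) i j, ?_⟩
    rw [hAB, ← Matrix.map_pow]
    simp
  have hone : ∀ i j, 1 ≤ (A ^ n) i j := fun i j => by
    obtain ⟨k, hk⟩ := hint n i j
    have := hn i j
    rw [hk] at this ⊢
    exact_mod_cast this
  obtain ⟨i, j, hij⟩ := exists_pair_ne ι
  have h : r ^ n * p i = ∑ k, (A ^ n) i k * p k := by
    have := congrFun (pow_mulVec_of_eigen hAp n) i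
    simpa [mulVec, dotProduct] using this.symm
  have h2 : p i + p j ≤ r ^ n * p i := by
    rw [h, ← Finset.sum_pair hij]
    refine (Finset.sum_le_sum fun k _ => le_mul_of_one_le_left (hp k).le (hone i k)).trans ?_
    exact Finset.sum_le_sum_of_subset_of_nonneg (Finset.subset_univ _)
      fun k _ _ => mul_nonneg (hn i k).le (hp k).le
  by_contra hlt
  have : r ^ n ≤ 1 := pow_le_one₀ hr (not_lt.1 hlt)
  have := mul_le_mul_of_nonneg_right this (hp i).le
  linarith [hp j]

end PerronFrobenius

/-! ### Markov measures on words -/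

namespace PerronFrobenius

open ProbabilityTheory Finset

variable {ι : Type*} [Fintype ι] [MeasurableSpace ι]

/-- The probability measure on a finite discrete space with given weights. -/
noncomputable def weighted (q : ι → ℝ) : Measure ι :=
  ∑ j, ENNReal.ofReal (q j) • Measure.dirac j

theorem isProbabilityMeasure_weighted {q : ι → ℝ} (h0 : ∀ j, 0 ≤ q j) (h1 : ∑ j, q j = 1) :
    IsProbabilityMeasure (weighted q) := by
  constructor
  simp [weighted, Measure.finsetSum_apply, ← ENNReal.ofReal_sum_of_nonneg fun j _ => h0 j, h1]

variable [DiscreteMeasurableSpace ι]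

theorem weighted_singleton (q : ι → ℝ) (j : ι) : weighted q {j} = ENNReal.ofReal (q j) := by
  classical
  simp [weighted, Measure.finsetSum_apply, Set.indicator_apply]

/-- The kernel with transition weights `P`, as a kernel on the space of histories. -/
noncomputable def historyKernel (P : ι → ι → ℝ) (n : ℕ) : Kernel (Π _ : Iic n, ι) ι :=
  (Kernel.ofFunOfCountable fun i => weighted (P i) : Kernel ι ι).comap
    (fun h => h ⟨n, mem_Iic.2 le_rfl⟩) (measurable_pi_apply _)

theorem historyKernel_apply (P : ι → ι → ℝ) (n : ℕ) (h : Π _ : Iic n, ι) :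
    historyKernel P n h = weighted (P (h ⟨n, mem_Iic.2 le_rfl⟩)) := rfl

/-- The distribution of a Markov chain with given initial and transition probabilities. -/
theorem exists_markovChain {q : ι → ℝ} {P : ι → ι → ℝ} (hq0 : ∀ i, 0 ≤ q i)
    (hq1 : ∑ i, q i = 1) (hP0 : ∀ i j, 0 ≤ P i j) (hP1 : ∀ i, ∑ j, P i j = 1) :
    ∃ ν : Measure (ℕ → ι), IsProbabilityMeasure ν ∧ ∀ (u : ℕ → ι) (n : ℕ),
      ν {w | ∀ k ≤ n, w k = u k} =
        ENNReal.ofReal (q (u 0) * ∏ k ∈ range n, P (u k) (u (k + 1))) := by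
  have hq := isProbabilityMeasure_weighted hq0 hq1
  have hκ : ∀ n, IsMarkovKernel (historyKernel P n) := fun n =>
    ⟨fun h => isProbabilityMeasure_weighted (hP0 _) (hP1 _)⟩
  set ν : Measure (ℕ → ι) := Kernel.trajMeasure (X := fun _ => ι) (weighted q) (historyKernel P)
    with hν
  refine ⟨ν, inferInstance, fun u n => ?_⟩
  induction n with
  | zero =>
    have h : ν.map (Preorder.frestrictLe 0) =
        (weighted q).map (MeasurableEquiv.piUnique fun _ : Iic 0 => ι).symm := by
      rw [hν, Kernel.trajMeasure, Measure.map_comp _ _ (by fun_prop), Kernel.traj_map_frestrictLe,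
        Kernel.partialTraj_self, Measure.id_comp]
    have hS : {w : ℕ → ι | ∀ k ≤ 0, w k = u k} =
        Preorder.frestrictLe (π := fun _ => ι) 0 ⁻¹' {x | x ⟨0, mem_Iic.2 le_rfl⟩ = u 0} := by
      ext w
      simp
    have hm : MeasurableSet {x : Π _ : Iic 0, ι | x ⟨0, mem_Iic.2 le_rfl⟩ = u 0} :=
      (Set.toFinite _).measurableSet
    rw [hS, ← Measure.map_apply (by fun_prop) hm, h, Measure.map_apply (by fun_prop) hm]
    simp only [range_zero, prod_empty, mul_one, ← weighted_singleton]
    congr 1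
  | succ n ih =>
    set S : Set (Π _ : Iic n, ι) := {x | ∀ k, x k = u k} with hSdef
    have hSm : MeasurableSet S := (Set.toFinite S).measurableSet
    have hS : {w : ℕ → ι | ∀ k ≤ n + 1, w k = u k} =
        (fun x : ℕ → ι => (Preorder.frestrictLe (π := fun _ => ι) n x, x (n + 1))) ⁻¹'
          (S ×ˢ {u (n + 1)}) := by
      ext w
      simp [hSdef, Nat.le_succ_iff, or_imp, forall_and]
    have hS' : {w : ℕ → ι | ∀ k ≤ n, w k = u k} =
        Preorder.frestrictLe (π := fun _ => ι) n ⁻¹' S := by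
      ext w
      simp [hSdef]
    have hpos : 0 ≤ q (u 0) * ∏ k ∈ range n, P (u k) (u (k + 1)) :=
      mul_nonneg (hq0 _) (prod_nonneg fun k _ => hP0 _ _)
    -- The joint law of the history up to `n` and the next letter is the composition product with
    -- the kernel, which is constant on the single history in `S`.
    rw [hS, ← Measure.map_apply (by fun_prop) (hSm.prod (measurableSet_singleton _)),
      ← Kernel.map_frestrictLe_trajMeasure_compProd_eq_map_trajMeasure,
      Measure.compProd_apply_prod hSm (measurableSet_singleton _),
      setLIntegral_congr_fun (g := fun _ => ENNReal.ofReal (P (u n) (u (n + 1)))) hSm,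
      setLIntegral_const, Measure.map_apply (by fun_prop) hSm, ← hS', ih, prod_range_succ,
      ← ENNReal.ofReal_mul (hP0 _ _)]
    · congr 1
      ring
    · intro x hx
      simp only [historyKernel_apply, weighted_singleton]
      rw [hx]

/-- The Parry measure of cylinders: the Markov measure attached to a positive eigenvector. -/
theorem exists_parryMeasure {A : Matrix ι ι ℝ} (h0 : ∀ i j, 0 ≤ A i j) {r : ℝ} (hr : 0 < r)
    {p : ι → ℝ} (hp : ∀ i, 0 < p i) (hAp : A.mulVec p = r • p) (hp1 : ∑ i, p i = 1) :
    ∃ ν : Measure (ℕ → ι), IsProbabilityMeasure ν ∧ ∀ (u : ℕ → ι) (n : ℕ),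
      ν {w | ∀ k ≤ n, w k = u k} =
        ENNReal.ofReal ((r ^ n)⁻¹ * p (u n) * ∏ k ∈ range n, A (u k) (u (k + 1))) := by
  -- The eigenvector equation says exactly that these rows sum to 1. Along a word the quotients `p j
  -- / p i` telescope.
  obtain ⟨ν, hν, h⟩ := exists_markovChain (q := p) (P := fun i j => A i j * p j / (r * p i))
    (fun i => (hp i).le) hp1
    (fun i j => div_nonneg (mul_nonneg (h0 i j) (hp j).le) (mul_nonneg hr.le (hp i).le))
    (fun i => by
      rw [← sum_div, div_eq_one_iff_eq (mul_pos hr (hp i)).ne']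
      exact congrFun hAp i)
  refine ⟨ν, hν, fun u n => ?_⟩
  rw [h]
  congr 1
  induction n with
  | zero => simp
  | succ n ih =>
    rw [prod_range_succ, ← mul_assoc, ih, prod_range_succ, pow_succ]
    have := (hp (u n)).ne'
    field_simp

end PerronFrobenius

/-! ### Hausdorff measure of the limit set: positivity and finiteness -/

namespace AdmissibleCantor

open Filter Topology

variable {N : ℕ}

/-- The integer whose base `N` digits are the first `n` letters of `w`. -/
def prefixValue (w : ℕ → Fin N) : ℕ → ℕ
  | 0 => 0
  | n + 1 => N * prefixValue w n + w n

theorem prefixValue_eq (hN : N ≠ 0) (w : ℕ → Fin N) (n : ℕ) :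
    (prefixValue w n : ℝ) = (N : ℝ) ^ n * ∑ i ∈ Finset.range n, Real.ofDigitsTerm w i := by
  have : (N : ℝ) ≠ 0 := Nat.cast_ne_zero.2 hN
  induction n with
  | zero => simp [prefixValue]
  | succ n ih =>
    rw [Finset.sum_range_succ, prefixValue, Nat.cast_add, Nat.cast_mul, ih, Real.ofDigitsTerm,
      mul_add, mul_left_comm _ ((w n : ℕ) : ℝ), mul_inv_cancel₀ (pow_ne_zero _ this), pow_succ']
    ring

theorem prefixValue_injective {w u : ℕ → Fin N} {n : ℕ} (h : prefixValue w n = prefixValue u n) :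
    ∀ k < n, w k = u k := by
  induction n with
  | zero => simp
  | succ n ih =>
    rw [prefixValue, prefixValue] at h
    have hN : 0 < N := (w 0).pos
    have h1 : prefixValue w n = prefixValue u n := by
      have := congrArg (· / N) h
      simpa [Nat.mul_add_div hN, Nat.div_eq_of_lt (Fin.is_lt _)] using this
    have h2 : w n = u n := Fin.ext (by rw [h1] at h; omega)
    intro k hk
    rcases Nat.lt_succ_iff_lt_or_eq.1 hk with hk | rfl
    exacts [ih h1 k hk, h2]

/-- The remaining tail has a value in `[0, 1]`. The value 1 can occur, so the prefix need not be the
integer part. -/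
theorem prefixValue_bounds (w : ℕ → Fin N) (n : ℕ) :
    (prefixValue w n : ℝ) ≤ (N : ℝ) ^ n * Real.ofDigits w ∧
      (N : ℝ) ^ n * Real.ofDigits w ≤ prefixValue w n + 1 := by
  have hN : N ≠ 0 := (w 0).pos.ne'
  have hpow : (N : ℝ) ^ n ≠ 0 := pow_ne_zero _ (Nat.cast_ne_zero.2 hN)
  rw [prefixValue_eq hN, Real.ofDigits_eq_sum_add_ofDigits w n, mul_add, mul_inv_cancel_left₀ hpow]
  have h0 := Real.ofDigits_nonneg fun i => w (i + n)
  have h1 := Real.ofDigits_le_one fun i => w (i + n)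
  constructor <;> linarith

/-- If cylinders of length `n + 1` have mass at most `r⁻ⁿ`, then sets of diameter at most
`N⁻ⁿ⁻¹` have mass at most `4 r⁻ⁿ`. -/
theorem measure_preimage_ofDigits_le {ν : Measure (ℕ → Fin N)} {r : ℝ} {n : ℕ}
    (hν : ∀ u : ℕ → Fin N, ν {w | ∀ k ≤ n, w k = u k} ≤ ENNReal.ofReal (r ^ n)⁻¹)
    {s : Set ℝ} (hs : ∀ x ∈ s, ∀ y ∈ s, |x - y| ≤ ((N : ℝ) ^ (n + 1))⁻¹) :
    ν (Real.ofDigits ⁻¹' s) ≤ ENNReal.ofReal (4 * (r ^ n)⁻¹) := by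
  rcases (Real.ofDigits (b := N) ⁻¹' s).eq_empty_or_nonempty with he | ⟨w₀, hw₀⟩
  · simp [he]
  have hNpos : (0 : ℝ) < N := Nat.cast_pos.2 (w₀ 0).pos
  set M : ℝ := (N : ℝ) ^ (n + 1) with hM
  have hMpos : 0 < M := pow_pos hNpos _
  set a := Real.ofDigits w₀
  -- A prefix is within 1 below `M * x`, which is within 1 of `M * a`. So it lies in `[M * a - 2, M
  -- * a + 1]`, which leaves four candidate integers.
  have hsub : Real.ofDigits (b := N) ⁻¹' s ⊆
      ⋃ k ∈ Finset.Icc (⌊M * a⌋ - 2) (⌊M * a⌋ + 1),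
        {w : ℕ → Fin N | (prefixValue w (n + 1) : ℤ) = k} := by
    intro w hw
    obtain ⟨h1, h2⟩ := prefixValue_bounds w (n + 1)
    have h3 : |M * Real.ofDigits w - M * a| ≤ 1 := by
      rw [← mul_sub, abs_mul, abs_of_pos hMpos]
      calc M * |Real.ofDigits w - a| ≤ M * M⁻¹ :=
            mul_le_mul_of_nonneg_left (hs _ hw _ hw₀) hMpos.le
        _ = 1 := mul_inv_cancel₀ hMpos.ne'
    rw [← hM] at h1 h2
    obtain ⟨h4, h5⟩ := abs_le.1 h3
    have h6 := Int.floor_le (M * a)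
    have h7 := Int.lt_floor_add_one (M * a)
    simp only [Set.mem_iUnion, Finset.mem_Icc, Set.mem_ofPred_eq, exists_prop, exists_eq_right']
    constructor
    · have : ((⌊M * a⌋ - 2 : ℤ) : ℝ) ≤ ((prefixValue w (n + 1) : ℤ) : ℝ) := by
        push_cast
        linarith
      exact_mod_cast this
    · have : ((prefixValue w (n + 1) : ℤ) : ℝ) < ((⌊M * a⌋ + 2 : ℤ) : ℝ) := by
        push_cast
        linarith
      have : (prefixValue w (n + 1) : ℤ) < ⌊M * a⌋ + 2 := by exact_mod_cast this
      omega
  have hcard : (Finset.Icc (⌊M * a⌋ - 2) (⌊M * a⌋ + 1)).card = 4 := by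
    rw [Int.card_Icc]
    omega
  have hone : ∀ k : ℤ, ν {w : ℕ → Fin N | (prefixValue w (n + 1) : ℤ) = k} ≤
      ENNReal.ofReal (r ^ n)⁻¹ := by
    intro k
    rcases {w : ℕ → Fin N | (prefixValue w (n + 1) : ℤ) = k}.eq_empty_or_nonempty with he | ⟨u, hu⟩
    · simp [he]
    refine le_trans (measure_mono fun w hw => ?_) (hν u)
    have hwu : prefixValue w (n + 1) = prefixValue u (n + 1) := by
      have h1 : (prefixValue w (n + 1) : ℤ) = k := hw
      have h2 : (prefixValue u (n + 1) : ℤ) = k := hu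
      exact_mod_cast h1.trans h2.symm
    exact fun k hk => prefixValue_injective hwu k (Nat.lt_succ_of_le hk)
  calc ν (Real.ofDigits ⁻¹' s)
      ≤ ∑ k ∈ Finset.Icc (⌊M * a⌋ - 2) (⌊M * a⌋ + 1),
          ν {w : ℕ → Fin N | (prefixValue w (n + 1) : ℤ) = k} :=
        (measure_mono hsub).trans (measure_biUnion_finset_le _ _)
    _ ≤ ∑ k ∈ Finset.Icc (⌊M * a⌋ - 2) (⌊M * a⌋ + 1), ENNReal.ofReal (r ^ n)⁻¹ :=
        Finset.sum_le_sum fun k _ => hone k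
    _ = ENNReal.ofReal (4 * (r ^ n)⁻¹) := by
        rw [Finset.sum_const, hcard, ENNReal.ofReal_mul (by norm_num)]
        simp

theorem natCast_rpow_log_div_log {r : ℝ} (hN : 2 ≤ N) (hr : 0 < r) :
    (N : ℝ) ^ (Real.log r / Real.log N) = r := by
  have hN' : (1 : ℝ) < N := by exact_mod_cast hN
  exact Real.rpow_logb (by positivity) hN'.ne' hr

theorem inv_pow_rpow {r δ : ℝ} (hδ : (N : ℝ) ^ δ = r) (n : ℕ) :
    (((N : ℝ) ^ n)⁻¹) ^ δ = (r ^ n)⁻¹ := by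
  rw [Real.inv_rpow (by positivity), ← Real.rpow_natCast, ← Real.rpow_mul (Nat.cast_nonneg _),
    mul_comm, Real.rpow_mul (Nat.cast_nonneg _), hδ, Real.rpow_natCast]

/-- The mass distribution principle for a measure on digit sequences with exponentially small
cylinders. -/
theorem map_ofDigits_le_hausdorffMeasure (hN : 2 ≤ N) {ν : Measure (ℕ → Fin N)} {r δ : ℝ}
    (hr : 1 < r) (hδ0 : 0 < δ) (hδ : (N : ℝ) ^ δ = r)
    (hν : ∀ (u : ℕ → Fin N) (n : ℕ), ν {w | ∀ k ≤ n, w k = u k} ≤ ENNReal.ofReal (r ^ n)⁻¹) :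
    (ENNReal.ofReal (4 * r ^ 2))⁻¹ • ν.map Real.ofDigits ≤ Measure.hausdorffMeasure δ := by
  have hr0 : 0 < r := one_pos.trans hr
  have hN1 : (1 : ℝ) < N := by exact_mod_cast hN
  have hNpos : (0 : ℝ) < N := one_pos.trans hN1
  refine Measure.le_hausdorffMeasure δ _ (ENNReal.ofReal (N : ℝ)⁻¹)
    (ENNReal.ofReal_pos.2 (inv_pos.2 hNpos)) fun s hs => ?_
  have hfin : Metric.ediam s ≠ ∞ := ne_top_of_le_ne_top ENNReal.ofReal_ne_top hs
  have hC : ENNReal.ofReal (4 * r ^ 2) ≠ 0 := (ENNReal.ofReal_pos.2 (by positivity)).ne'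
  rw [Measure.smul_apply, smul_eq_mul,
    ENNReal.inv_mul_le_iff hC ENNReal.ofReal_ne_top]
  -- The closure is measurable and has the same diameter.
  refine (measure_mono subset_closure).trans ?_
  rw [Measure.map_apply Real.continuous_ofDigits.measurable isClosed_closure.measurableSet]
  set d := (Metric.ediam s).toReal with hd
  have hdE : Metric.ediam s = ENNReal.ofReal d := (ENNReal.ofReal_toReal hfin).symm
  have hd0 : 0 ≤ d := ENNReal.toReal_nonneg
  have hdN : d ≤ (N : ℝ)⁻¹ := by
    rw [hdE] at hs
    exact (ENNReal.ofReal_le_ofReal_iff (inv_nonneg.2 hNpos.le)).1 hs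
  have hdiam : ∀ x ∈ closure s, ∀ y ∈ closure s, |x - y| ≤ d := by
    intro x hx y hy
    have := Metric.edist_le_ediam_of_mem hx hy
    rw [Metric.ediam_closure, hdE, edist_dist, ENNReal.ofReal_le_ofReal_iff hd0] at this
    exact this
  have hmass : ∀ n : ℕ, d ≤ ((N : ℝ) ^ (n + 1))⁻¹ →
      ν (Real.ofDigits ⁻¹' closure s) ≤ ENNReal.ofReal (4 * (r ^ n)⁻¹) := fun n hn =>
    measure_preimage_ofDigits_le (fun u => hν u n) fun x hx y hy => (hdiam x hx y hy).trans hn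
  -- Diameter zero satisfies the bound at every scale, so the mass is zero.
  rcases hd0.eq_or_lt with h0 | hpos
  · have hlim : Tendsto (fun n : ℕ => ENNReal.ofReal (4 * (r ^ n)⁻¹)) atTop (𝓝 0) := by
      have h := (tendsto_inv_atTop_zero.comp (tendsto_pow_atTop_atTop_of_one_lt hr)).const_mul 4
      rw [mul_zero] at h
      simpa using ENNReal.tendsto_ofReal h
    have : ν (Real.ofDigits ⁻¹' closure s) ≤ 0 :=
      ge_of_tendsto' hlim fun n => hmass n (by rw [← h0]; positivity)
    exact this.trans zero_le
  -- Choose the scale with `N⁻ⁿ⁻² < d ≤ N⁻ⁿ⁻¹`, possible because `d ≤ N⁻¹`. Passing from `r⁻ⁿ` to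
  -- `r⁻ⁿ⁻²` costs the `r ^ 2` in the constant; the 4 counts prefixes.
  · obtain ⟨n, hn1, hn2⟩ := exists_nat_pow_near_of_lt_one (x := d * N) (mul_pos hpos hNpos)
      (by rwa [← le_div_iff₀ hNpos, one_div]) (inv_pos.2 hNpos) (inv_lt_one_of_one_lt₀ hN1)
    have h1 : d ≤ ((N : ℝ) ^ (n + 1))⁻¹ := by
      rw [pow_succ, mul_inv, ← inv_pow, ← div_eq_mul_inv, le_div_iff₀ hNpos]
      exact hn2
    have h2 : ((N : ℝ) ^ (n + 2))⁻¹ ≤ d := by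
      rw [pow_succ, mul_inv, ← inv_pow, ← div_eq_mul_inv, div_le_iff₀ hNpos]
      exact hn1.le
    have h3 : (r ^ (n + 2))⁻¹ ≤ d ^ δ := by
      rw [← inv_pow_rpow hδ]
      exact Real.rpow_le_rpow (by positivity) h2 hδ0.le
    refine (hmass n h1).trans ?_
    rw [hdE, ENNReal.ofReal_rpow_of_nonneg hd0 hδ0.le, ← ENNReal.ofReal_mul (by positivity)]
    refine ENNReal.ofReal_le_ofReal ?_
    have h4 : (r ^ n)⁻¹ = r ^ 2 * (r ^ (n + 2))⁻¹ := by
      field_simp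
      ring
    rw [h4, ← mul_assoc]
    exact mul_le_mul_of_nonneg_left h3 (by positivity)

theorem isOpen_cylinder (u : ℕ → Fin N) (n : ℕ) : IsOpen {w : ℕ → Fin N | ∀ k ≤ n, w k = u k} := by
  have : {w : ℕ → Fin N | ∀ k ≤ n, w k = u k} = ⋂ k ∈ Set.Iic n, {w | w k = u k} := by
    ext w
    simp
  rw [this]
  exact (Set.finite_Iic n).isOpen_biInter fun k _ =>
    (isOpen_discrete {u k}).preimage (f := fun w : ℕ → Fin N => w k) (continuous_apply k)

theorem isClosed_words (A : Matrix (Fin N) (Fin N) ℝ) : IsClosed (words A) := by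
  simp only [words, Set.ofPred_forall]
  refine isClosed_iInter fun n => ?_
  exact (isClosed_discrete {q : Fin N × Fin N | A q.1 q.2 = 1}).preimage
    (f := fun w : ℕ → Fin N => (w n, w (n + 1)))
    ((continuous_apply n).prodMk (continuous_apply (n + 1)))

theorem isCompact_limitSet (A : Matrix (Fin N) (Fin N) ℝ) : IsCompact (limitSet A) :=
  (isClosed_words A).isCompact.image Real.continuous_ofDigits

/-- A word that is not admissible contains a forbidden transition, and the open cylinder ending
there has a zero factor in its mass. -/
theorem parryMeasure_words {A : Matrix (Fin N) (Fin N) ℝ}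
    {r : ℝ} {p : Fin N → ℝ} {ν : Measure (ℕ → Fin N)}
    (hA : ∀ i j, A i j = 0 ∨ A i j = 1)
    (hν : ∀ (u : ℕ → Fin N) (n : ℕ), ν {w | ∀ k ≤ n, w k = u k} =
      ENNReal.ofReal ((r ^ n)⁻¹ * p (u n) * ∏ k ∈ Finset.range n, A (u k) (u (k + 1)))) :
    ν (words A)ᶜ = 0 := by
  refine measure_null_of_locally_null _ fun u hu => ?_
  obtain ⟨n, hn⟩ := not_forall.1 hu
  refine ⟨{w | ∀ k ≤ n + 1, w k = u k},
    mem_nhdsWithin_of_mem_nhds ((isOpen_cylinder u (n + 1)).mem_nhds fun k _ => rfl), ?_⟩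
  rw [hν, Finset.prod_eq_zero (Finset.self_mem_range_succ n) ((hA _ _).resolve_right hn)]
  simp

theorem hausdorffMeasure_limitSet_pos {A : Matrix (Fin N) (Fin N) ℝ}
    {r δ : ℝ} {p : Fin N → ℝ} {ν : Measure (ℕ → Fin N)} [IsProbabilityMeasure ν]
    (hA : ∀ i j, A i j = 0 ∨ A i j = 1)
    (hν : ∀ (u : ℕ → Fin N) (n : ℕ), ν {w | ∀ k ≤ n, w k = u k} =
      ENNReal.ofReal ((r ^ n)⁻¹ * p (u n) * ∏ k ∈ Finset.range n, A (u k) (u (k + 1))))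
    (hN : 2 ≤ N) (hr : 1 < r) (hδ0 : 0 < δ)
    (hδ : (N : ℝ) ^ δ = r) (hp : ∀ i, 0 < p i) (hp1 : ∑ i, p i = 1) :
    0 < Measure.hausdorffMeasure δ (limitSet A) := by
  have hr0 : 0 < r := one_pos.trans hr
  have hcyl : ∀ (u : ℕ → Fin N) (n : ℕ),
      ν {w | ∀ k ≤ n, w k = u k} ≤ ENNReal.ofReal (r ^ n)⁻¹ := by
    intro u n
    rw [hν, mul_assoc]
    refine ENNReal.ofReal_le_ofReal (mul_le_of_le_one_right (by positivity) ?_)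
    have h1 : p (u n) ≤ 1 :=
      hp1 ▸ Finset.single_le_sum (fun k _ => (hp k).le) (Finset.mem_univ (u n))
    refine mul_le_one₀ h1 (Finset.prod_nonneg fun k _ => ?_) (Finset.prod_le_one (fun k _ => ?_)
      fun k _ => ?_) <;> rcases hA (u k) (u (k + 1)) with h | h <;> simp [h]
  have hle := map_ofDigits_le_hausdorffMeasure hN hr hδ0 hδ hcyl (limitSet A)
  refine lt_of_lt_of_le ?_ hle
  rw [Measure.smul_apply, smul_eq_mul]
  have h1 : ν (words A) = 1 :=
    (prob_compl_eq_zero_iff (isClosed_words A).measurableSet).1 (parryMeasure_words hA hν)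
  -- An inequality suffices; a point of `Λ_A` may also have an expansion that is not admissible.
  have h2 : 1 ≤ ν.map Real.ofDigits (limitSet A) := by
    rw [← h1, Measure.map_apply Real.continuous_ofDigits.measurable
      (isCompact_limitSet A).measurableSet]
    exact measure_mono (Set.subset_preimage_image _ _)
  exact ENNReal.mul_pos (ENNReal.inv_ne_zero.2 ENNReal.ofReal_ne_top) (one_pos.trans_le h2).ne'

/-- At each level the images of the cylinders cover `Λ_A`. The `δ`-th power of each diameter is at
most the cylinder's mass divided by `min p`, and the masses of the disjoint cylinders sum to 1. -/
theorem hausdorffMeasure_limitSet_lt_top {A : Matrix (Fin N) (Fin N) ℝ}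
    {r δ : ℝ} {p : Fin N → ℝ} {ν : Measure (ℕ → Fin N)} [IsProbabilityMeasure ν]
    (hν : ∀ (u : ℕ → Fin N) (n : ℕ), ν {w | ∀ k ≤ n, w k = u k} =
      ENNReal.ofReal ((r ^ n)⁻¹ * p (u n) * ∏ k ∈ Finset.range n, A (u k) (u (k + 1))))
    (hN : 2 ≤ N) (hr : 1 < r) (hδ0 : 0 < δ)
    (hδ : (N : ℝ) ^ δ = r) (hp : ∀ i, 0 < p i) :
    Measure.hausdorffMeasure δ (limitSet A) < ∞ := by
  have hr0 : 0 < r := one_pos.trans hr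
  have hN1 : (1 : ℝ) < N := by exact_mod_cast hN
  have : Nonempty (Fin N) := ⟨⟨0, by omega⟩⟩
  obtain ⟨i₀, -, hi₀⟩ := Finset.exists_min_image Finset.univ p Finset.univ_nonempty
  let f : ∀ n, (ℕ → Fin N) → (Finset.Iic n → Fin N) := fun n =>
    Preorder.frestrictLe (π := fun _ => Fin N) n
  let t : ∀ n, (Finset.Iic n → Fin N) → Set ℝ := fun n v =>
    Real.ofDigits '' (words A ∩ f n ⁻¹' {v})
  have hdiam : ∀ n v, Metric.ediam (t n v) ≤ ENNReal.ofReal ((N : ℝ) ^ (n + 1))⁻¹ := by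
    rintro n v
    refine Metric.ediam_le ?_
    rintro _ ⟨w, ⟨-, hw⟩, rfl⟩ _ ⟨u, ⟨-, hu⟩, rfl⟩
    rw [edist_dist]
    refine ENNReal.ofReal_le_ofReal (Real.abs_ofDigits_sub_ofDigits_le fun i hi => ?_)
    exact congrFun ((show f n w = v from hw).trans (show f n u = v from hu).symm)
      ⟨i, Finset.mem_Iic.2 (Nat.lt_succ_iff.1 hi)⟩
  have hlim : Tendsto (fun n : ℕ => ENNReal.ofReal ((N : ℝ) ^ (n + 1))⁻¹) atTop (𝓝 0) := by
    have h := (tendsto_inv_atTop_zero.comp (tendsto_pow_atTop_atTop_of_one_lt hN1)).comp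
      (tendsto_add_atTop_nat 1)
    simpa using ENNReal.tendsto_ofReal h
  have hcover : ∀ n, limitSet A ⊆ ⋃ v, t n v := by
    rintro n _ ⟨w, hw, rfl⟩
    exact Set.mem_iUnion.2 ⟨f n w, w, ⟨hw, rfl⟩, rfl⟩
  refine (Measure.hausdorffMeasure_le_liminf_sum δ (limitSet A) _ hlim t
    (Eventually.of_forall hdiam) (Eventually.of_forall hcover)).trans_lt ?_
  refine lt_of_le_of_lt (b := ENNReal.ofReal (p i₀)⁻¹) ?_ ENNReal.ofReal_lt_top
  refine liminf_le_of_frequently_le' (Frequently.of_forall fun n => ?_)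
  have hterm : ∀ v, Metric.ediam (t n v) ^ δ ≤ ENNReal.ofReal (p i₀)⁻¹ * ν (f n ⁻¹' {v}) := by
    intro v
    rcases (words A ∩ f n ⁻¹' {v}).eq_empty_or_nonempty with he | ⟨u, hu, huv⟩
    -- An empty piece contributes `0 ^ δ`, which is zero because `δ > 0`.
    · simp [t, he, hδ0]
    have hcyl : f n ⁻¹' {v} = {w | ∀ k ≤ n, w k = u k} := by
      ext w
      rw [← show f n u = v from huv]
      simp [f, funext_iff]
    rw [hcyl, hν, Finset.prod_eq_one fun k _ => hu k, mul_one,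
      ← ENNReal.ofReal_mul (inv_nonneg.2 (hp i₀).le)]
    refine (ENNReal.rpow_le_rpow (hdiam n v) hδ0.le).trans ?_
    rw [ENNReal.ofReal_rpow_of_nonneg (by positivity) hδ0.le, inv_pow_rpow hδ]
    refine ENNReal.ofReal_le_ofReal ?_
    have h1 : (r ^ (n + 1))⁻¹ ≤ (r ^ n)⁻¹ :=
      inv_anti₀ (by positivity) (pow_le_pow_right₀ hr.le (Nat.le_succ n))
    have h2 : 1 ≤ (p i₀)⁻¹ * p (u n) := by
      rw [inv_mul_eq_div, one_le_div (hp i₀)]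
      exact hi₀ _ (Finset.mem_univ _)
    calc (r ^ (n + 1))⁻¹ ≤ (r ^ n)⁻¹ * 1 := by rwa [mul_one]
      _ ≤ (r ^ n)⁻¹ * ((p i₀)⁻¹ * p (u n)) := by gcongr
      _ = (p i₀)⁻¹ * ((r ^ n)⁻¹ * p (u n)) := by ring
  calc ∑ v, Metric.ediam (t n v) ^ δ
      ≤ ∑ v, ENNReal.ofReal (p i₀)⁻¹ * ν (f n ⁻¹' {v}) := Finset.sum_le_sum fun v _ => hterm v
    _ = ENNReal.ofReal (p i₀)⁻¹ * ν Set.univ := by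
      rw [← Finset.mul_sum, sum_measure_preimage_singleton]
      · simp
      · exact fun v _ => Preorder.measurable_frestrictLe n (measurableSet_singleton v)
    _ = ENNReal.ofReal (p i₀)⁻¹ := by simp

end AdmissibleCantor

/-! ### Self-similarity of the normalized Hausdorff measure -/

namespace AdmissibleCantor

variable {N : ℕ}

theorem sigma_injective (i : Fin N) : Function.Injective (sigma i) := by
  have hN : (N : ℝ) ≠ 0 := Nat.cast_ne_zero.2 i.pos.ne'
  intro x y h
  exact add_right_cancel ((div_left_inj' hN).1 h)

theorem continuous_sigma (i : Fin N) : Continuous (sigma i) := by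
  unfold sigma
  fun_prop

theorem measurableEmbedding_sigma (i : Fin N) : MeasurableEmbedding (sigma i) :=
  (continuous_sigma i).measurableEmbedding (sigma_injective i)

theorem hausdorffMeasure_sigma_image {d : ℝ} (hd : 0 ≤ d) (i : Fin N) (E : Set ℝ) :
    Measure.hausdorffMeasure d (sigma i '' E) =
      (N : ℝ≥0∞) ^ (-d) * Measure.hausdorffMeasure d E := by
  have hN : N ≠ 0 := i.pos.ne'
  have hN' : (N : ℝ)⁻¹ ≠ 0 := inv_ne_zero (Nat.cast_ne_zero.2 hN)
  have himage : sigma i '' E =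
      IsometryEquiv.addRight (((i : ℕ) : ℝ) / N) '' ((fun x : ℝ => (N : ℝ)⁻¹ • x) '' E) := by
    rw [Set.image_image]
    refine Set.image_congr' fun x => ?_
    simp [sigma, div_eq_inv_mul, mul_add]
  rw [himage, IsometryEquiv.hausdorffMeasure_image, Set.image_smul,
    Measure.hausdorffMeasure_smul₀ hd hN', ENNReal.smul_def, smul_eq_mul,
    ENNReal.coe_rpow_of_nonneg _ hd, nnnorm_inv, Real.nnnorm_natCast,
    ENNReal.coe_inv (Nat.cast_ne_zero.2 hN), ENNReal.coe_natCast, ENNReal.inv_rpow,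
    ENNReal.rpow_neg]

variable (A : Matrix (Fin N) (Fin N) ℝ)

theorem isClosed_range (i : Fin N) : IsClosed (range A i) := by
  rw [range_eq]
  have h : IsClosed {w : ℕ → Fin N | w 0 = i} :=
    (isClosed_discrete {i}).preimage (f := fun w : ℕ → Fin N => w 0) (continuous_apply 0)
  exact (((isClosed_words A).inter h).isCompact.image Real.continuous_ofDigits).isClosed

theorem range_subset_limitSet (i : Fin N) : range A i ⊆ limitSet A := by
  rw [range_eq]
  exact Set.image_mono fun w hw => hw.1

theorem limitSet_eq_iUnion_range : limitSet A = ⋃ i, range A i := by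
  refine subset_antisymm ?_ (Set.iUnion_subset (range_subset_limitSet A))
  rintro _ ⟨w, hw, rfl⟩
  rw [Set.mem_iUnion]
  refine ⟨w 0, ?_⟩
  rw [range_eq]
  exact ⟨w, ⟨hw, rfl⟩, rfl⟩

theorem dom_eq_iUnion_range (i : Fin N) : dom A i = ⋃ j ∈ {j | A i j = 1}, range A j := by
  ext x
  simp only [Set.mem_iUnion, range_eq, dom, exists_prop]
  constructor
  · rintro ⟨w, ⟨hw, hi⟩, rfl⟩
    exact ⟨w 0, hi, w, ⟨hw, rfl⟩, rfl⟩
  · rintro ⟨j, hj, w, ⟨hw, rfl⟩, rfl⟩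
    exact ⟨w, ⟨hw, hj⟩, rfl⟩

theorem dom_subset_limitSet (i : Fin N) : dom A i ⊆ limitSet A :=
  Set.image_mono fun _ hw => hw.1

/-- The ranges of distinct `sigma i` and `sigma j` meet at most in one `N`-adic rational. -/
theorem range_inter_range_subset {i j : Fin N} (hij : i < j) :
    range A i ∩ range A j ⊆ {((j : ℕ) : ℝ) / N} := by
  have hN : (0 : ℝ) < N := Nat.cast_pos.2 i.pos
  have hij' : ((i : ℕ) : ℝ) + 1 ≤ (j : ℕ) := by exact_mod_cast hij
  rintro _ ⟨⟨_, ⟨w, -, rfl⟩, rfl⟩, ⟨_, ⟨u, -, rfl⟩, hu⟩⟩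
  have h : Real.ofDigits u + (j : ℕ) = Real.ofDigits w + (i : ℕ) := (div_left_inj' hN.ne').1 hu
  have h1 := Real.ofDigits_nonneg u
  have h2 := Real.ofDigits_le_one w
  -- Since `i + 1 ≤ j`, the equality forces tail value 1 after the digit `i` and 0 after `j`.
  rw [Set.mem_singleton_iff, sigma, div_left_inj' hN.ne']
  linarith

theorem aedisjoint_range {μ : Measure ℝ} (hμ : ∀ x, μ {x} = 0) {i j : Fin N} (hij : i ≠ j) :
    AEDisjoint μ (range A i) (range A j) := by
  rcases hij.lt_or_gt with h | h
  · exact measure_mono_null (range_inter_range_subset A h) (hμ _)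
  · exact AEDisjoint.symm (measure_mono_null (range_inter_range_subset A h) (hμ _))

theorem measure_inter_limitSet {μ : Measure ℝ} (hμ : ∀ x, μ {x} = 0) {E : Set ℝ}
    (hE : MeasurableSet E) : μ (E ∩ limitSet A) = ∑ i, μ (E ∩ range A i) := by
  rw [limitSet_eq_iUnion_range, Set.inter_iUnion, measure_iUnion₀, tsum_fintype]
  · exact fun i j hij =>
      (aedisjoint_range A hμ hij).mono Set.inter_subset_right Set.inter_subset_right
  · exact fun i => (hE.inter (isClosed_range A i).measurableSet).nullMeasurableSet

theorem measure_dom {μ : Measure ℝ} (hμ : ∀ x, μ {x} = 0) (hA : ∀ i j, A i j = 0 ∨ A i j = 1)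
    (i : Fin N) : μ (dom A i) = ∑ j, ENNReal.ofReal (A i j) * μ (range A j) := by
  classical
  have h : dom A i = ⋃ j ∈ Finset.univ.filter (A i · = 1), range A j := by
    simp [dom_eq_iUnion_range]
  rw [h, measure_biUnion_finset₀ (fun j _ k _ hjk => aedisjoint_range A hμ hjk)
    fun j _ => (isClosed_range A j).measurableSet.nullMeasurableSet, Finset.sum_filter]
  refine Finset.sum_congr rfl fun j _ => ?_
  rcases hA i j with h | h <;> simp [h]

theorem hMeasure_apply (E : Set ℝ) : hMeasure A E =
    (Measure.hausdorffMeasure (dimension A) (limitSet A))⁻¹ *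
      Measure.hausdorffMeasure (dimension A) (E ∩ limitSet A) := by
  rw [hMeasure, Measure.smul_apply, smul_eq_mul,
    Measure.restrict_apply' (isCompact_limitSet A).measurableSet]

theorem hMeasure_inter_limitSet (E : Set ℝ) :
    hMeasure A (E ∩ limitSet A) = hMeasure A E := by
  rw [hMeasure_apply, hMeasure_apply, Set.inter_assoc, Set.inter_self]

/-- Both `E` and its image lie in `Λ_A`, so restricting to `Λ_A` changes nothing and the Hausdorff
scaling carries over. -/
theorem hMeasure_sigma_image {i : Fin N} {E : Set ℝ} (hE : E ⊆ dom A i) :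
    hMeasure A (sigma i '' E) = (N : ℝ≥0∞) ^ (-dimension A) * hMeasure A E := by
  rw [hMeasure_apply, hMeasure_apply, Set.inter_eq_left.2 (hE.trans (dom_subset_limitSet A i)),
    Set.inter_eq_left.2 ((Set.image_mono hE).trans (range_subset_limitSet A i)),
    hausdorffMeasure_sigma_image (d := dimension A) ENNReal.toReal_nonneg, mul_left_comm]

theorem hMeasure_singleton (hδ : 0 < dimension A) (x : ℝ) : hMeasure A {x} = 0 := by
  have := Measure.nullSingletonClass_hausdorff ℝ hδ
  rw [hMeasure_apply, measure_mono_null Set.inter_subset_left (measure_singleton x), mul_zero]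

theorem measureComp_eq (i : Fin N) : measureComp A i =
    (N : ℝ≥0∞) ^ (-dimension A) • (hMeasure A).restrict (dom A i) := by
  ext E hE
  rw [measureComp, Measure.restrict_apply hE, (measurableEmbedding_sigma i).comap_apply,
    hMeasure_sigma_image A Set.inter_subset_right, Measure.smul_apply, smul_eq_mul,
    Measure.restrict_apply hE]

/-- Split `E` along the almost disjoint ranges: `E ∩ R_k` is the image under `sigma k` of the part
of `D_k` sent into `E`. -/
theorem hMeasure_eq_sum_measureCompInv (hδ : 0 < dimension A) :
    hMeasure A = (N : ℝ≥0∞) ^ (-dimension A) • ∑ k, measureCompInv A k := by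
  ext E hE
  rw [Measure.smul_apply, smul_eq_mul, Measure.finsetSum_apply, Finset.mul_sum,
    ← hMeasure_inter_limitSet, measure_inter_limitSet A (hMeasure_singleton A hδ) hE]
  refine Finset.sum_congr rfl fun k _ => ?_
  have hm := (continuous_sigma k).measurable
  rw [measureCompInv, Measure.map_apply hm hE, Measure.restrict_apply (hm hE),
    ← hMeasure_sigma_image A Set.inter_subset_right, Set.image_preimage_inter, range]

variable {A}

theorem dimension_of_hausdorffMeasure {d : ℝ} (hd : 0 ≤ d)
    (h0 : 0 < Measure.hausdorffMeasure d (limitSet A))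
    (htop : Measure.hausdorffMeasure d (limitSet A) < ∞) :
    dimH (limitSet A) = ENNReal.ofReal d ∧ dimension A = d := by
  lift d to NNReal using hd
  have h := dimH_of_hausdorffMeasure_ne_zero_ne_top h0.ne' htop.ne
  rw [dimension, h]
  simp

theorem hMeasure_limitSet (h0 : 0 < Measure.hausdorffMeasure (dimension A) (limitSet A))
    (htop : Measure.hausdorffMeasure (dimension A) (limitSet A) < ∞) :
    hMeasure A (limitSet A) = 1 := by
  rw [hMeasure_apply, Set.inter_self, ENNReal.inv_mul_cancel h0.ne' htop.ne]

theorem isFiniteMeasure_hMeasure (h : hMeasure A (limitSet A) = 1) :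
    IsFiniteMeasure (hMeasure A) := by
  constructor
  rw [← hMeasure_inter_limitSet, Set.univ_inter, h]
  exact ENNReal.one_lt_top

/-- The masses of the ranges form an eigenvector. -/
theorem mulVec_hMeasure_range (hA : ∀ i j, A i j = 0 ∨ A i j = 1) (hδ : 0 < dimension A)
    (h : hMeasure A (limitSet A) = 1) :
    A.mulVec (fun i => (hMeasure A (range A i)).toReal) =
      (N : ℝ) ^ dimension A • fun i => (hMeasure A (range A i)).toReal := by
  have := isFiniteMeasure_hMeasure h
  ext i
  have hN : (0 : ℝ) < N := Nat.cast_pos.2 i.pos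
  have hdom : (hMeasure A (dom A i)).toReal =
      ∑ j, A i j * (hMeasure A (range A j)).toReal := by
    rw [measure_dom A (hMeasure_singleton A hδ) hA, ENNReal.toReal_sum fun j _ =>
      ENNReal.mul_ne_top ENNReal.ofReal_ne_top (measure_ne_top _ _)]
    refine Finset.sum_congr rfl fun j _ => ?_
    rw [ENNReal.toReal_mul, ENNReal.toReal_ofReal]
    rcases hA i j with h | h <;> simp [h]
  have hrange : (hMeasure A (range A i)).toReal =
      (N : ℝ) ^ (-dimension A) * (hMeasure A (dom A i)).toReal := by
    rw [range, hMeasure_sigma_image A subset_rfl, ENNReal.toReal_mul, ← ENNReal.toReal_rpow,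
      ENNReal.toReal_natCast]
  rw [Pi.smul_apply, smul_eq_mul, hrange, ← mul_assoc, ← Real.rpow_add hN, add_neg_cancel,
    Real.rpow_zero, one_mul, hdom]
  rfl

theorem sum_hMeasure_range (hδ : 0 < dimension A) (h : hMeasure A (limitSet A) = 1) :
    ∑ i, (hMeasure A (range A i)).toReal = 1 := by
  have := isFiniteMeasure_hMeasure h
  have hsum := measure_inter_limitSet A (hMeasure_singleton A hδ) MeasurableSet.univ
  simp only [Set.univ_inter, h] at hsum
  rw [← ENNReal.toReal_sum fun i _ => measure_ne_top _ _, ← hsum, ENNReal.toReal_one]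

end AdmissibleCantor

theorem theorem2p16 (N : ℕ) (hN : 2 ≤ N) (A : Matrix (Fin N) (Fin N) ℝ)
    (hA : ∀ i j, A i j = 0 ∨ A i j = 1)
    (hirr : ∃ n : ℕ, ∀ i j, 0 < (A ^ n) i j) :
    -- the Hausdorff measure in dimension `δ_A` can be normalized
    (0 < Measure.hausdorffMeasure (AdmissibleCantor.dimension A) (AdmissibleCantor.limitSet A) ∧
      Measure.hausdorffMeasure (AdmissibleCantor.dimension A) (AdmissibleCantor.limitSet A) < ∞) ∧
    -- constant Radon-Nikodym derivatives on `D_i`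
    (∀ i, AdmissibleCantor.measureComp A i ≪
        (AdmissibleCantor.hMeasure A).restrict (AdmissibleCantor.dom A i) ∧
      (AdmissibleCantor.measureComp A i).rnDeriv
          ((AdmissibleCantor.hMeasure A).restrict (AdmissibleCantor.dom A i))
        =ᵐ[(AdmissibleCantor.hMeasure A).restrict (AdmissibleCantor.dom A i)]
          (fun _ => (N : ℝ≥0∞) ^ (-AdmissibleCantor.dimension A)) ∧
      ∀ E : Set ℝ, MeasurableSet E → E ⊆ AdmissibleCantor.dom A i →
        AdmissibleCantor.hMeasure A (AdmissibleCantor.sigma i '' E) =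
          (N : ℝ≥0∞) ^ (-AdmissibleCantor.dimension A) * AdmissibleCantor.hMeasure A E) ∧
    -- the masses of the ranges form the normalized Perron-Frobenius eigenvector
    (∃ p : Fin N → ℝ, (∀ i, 0 < p i) ∧
      A.mulVec p = AdmissibleCantor.specRadius A • p ∧ ∑ i, p i = 1 ∧
      (∀ q : Fin N → ℝ, A.mulVec q = AdmissibleCantor.specRadius A • q → ∑ i, q i = 1 → q = p) ∧
      ∀ i, AdmissibleCantor.hMeasure A (AdmissibleCantor.range A i) = ENNReal.ofReal (p i)) ∧
    -- the Hausdorff dimension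
    (dimH (AdmissibleCantor.limitSet A) ≠ ∞ ∧
      AdmissibleCantor.dimension A = Real.log (AdmissibleCantor.specRadius A) / Real.log N) ∧
    -- self-similarity
    AdmissibleCantor.hMeasure A =
      (N : ℝ≥0∞) ^ (-AdmissibleCantor.dimension A) •
        ∑ k, AdmissibleCantor.measureCompInv A k := by
  obtain ⟨n, hn⟩ := hirr
  have : Nontrivial (Fin N) := Fin.nontrivial_iff_two_le.2 hN
  have h0 : ∀ i j, 0 ≤ A i j := fun i j => by rcases hA i j with h | h <;> simp [h]
  obtain ⟨r, p, hr, hp, hAp, hp1⟩ := PerronFrobenius.exists_pos_eigenvector h0 hn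
  have hr1 : 1 < r := PerronFrobenius.one_lt_eigenvalue hA hn hr hp hAp
  have hr0 : 0 < r := one_pos.trans hr1
  have hspec : AdmissibleCantor.specRadius A = r :=
    PerronFrobenius.spectralRadius_eq h0 hr hp hAp
  have hN1 : (1 : ℝ) < N := by exact_mod_cast hN
  obtain ⟨ν, _, hν⟩ := PerronFrobenius.exists_parryMeasure h0 hr0 hp hAp hp1
  have hδ0 : 0 < Real.log r / Real.log N := div_pos (Real.log_pos hr1) (Real.log_pos hN1)
  have hδ := AdmissibleCantor.natCast_rpow_log_div_log hN hr0
  have hHpos := AdmissibleCantor.hausdorffMeasure_limitSet_pos hA hν hN hr1 hδ0 hδ hp hp1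
  have hHtop := AdmissibleCantor.hausdorffMeasure_limitSet_lt_top hν hN hr1 hδ0 hδ hp
  obtain ⟨hdimH, hdim⟩ := AdmissibleCantor.dimension_of_hausdorffMeasure hδ0.le hHpos hHtop
  -- From here on the exponent is `δ_A` itself, with `N ^ δ_A = r`.
  rw [← hdim] at hHpos hHtop hδ0 hδ
  have hone := AdmissibleCantor.hMeasure_limitSet hHpos hHtop
  have hfin := AdmissibleCantor.isFiniteMeasure_hMeasure hone
  have hc : (N : ℝ≥0∞) ^ (-AdmissibleCantor.dimension A) ≠ ∞ := by
    rw [ENNReal.rpow_neg]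
    refine ENNReal.inv_ne_top.2 (ENNReal.rpow_pos ?_ (ENNReal.natCast_ne_top N)).ne'
    exact_mod_cast (by omega : 0 < N)
  refine ⟨⟨hHpos, hHtop⟩, fun i => ⟨?_, ?_, fun E _ hE => ?_⟩, ⟨p, hp, ?_, hp1, ?_, ?_⟩,
    ⟨?_, ?_⟩, AdmissibleCantor.hMeasure_eq_sum_measureCompInv A hδ0⟩
  · rw [AdmissibleCantor.measureComp_eq]
    exact Measure.smul_absolutelyContinuous
  · rw [AdmissibleCantor.measureComp_eq]
    filter_upwards [Measure.rnDeriv_smul_left_of_ne_top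
      ((AdmissibleCantor.hMeasure A).restrict (AdmissibleCantor.dom A i))
      ((AdmissibleCantor.hMeasure A).restrict (AdmissibleCantor.dom A i)) hc,
      Measure.rnDeriv_self ((AdmissibleCantor.hMeasure A).restrict (AdmissibleCantor.dom A i))]
      with x hx hx1
    rw [hx, Pi.smul_apply, hx1, smul_eq_mul, mul_one]
  · exact AdmissibleCantor.hMeasure_sigma_image A hE
  · rw [hspec, hAp]
  · intro q hq hq1
    rw [hspec] at hq
    exact PerronFrobenius.eigenvector_unique hn hp hAp hq hp1 hq1
  · intro i
    -- The mass vector has eigenvalue `N ^ δ_A = r` and sum 1, so simplicity of `r` identifies it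
    -- with `p`.
    have hmass := AdmissibleCantor.mulVec_hMeasure_range hA hδ0 hone
    rw [hδ] at hmass
    rw [← PerronFrobenius.eigenvector_unique hn hp hAp hmass hp1
      (AdmissibleCantor.sum_hMeasure_range hδ0 hone), ENNReal.ofReal_toReal (measure_ne_top _ _)]
  · rw [hdimH]
    exact ENNReal.ofReal_ne_top
  · rw [hspec, hdim]
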